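/- Let $f\colon X\to Y$ be a finite-type morphism of noetherian schemes, and let $u\colon U\to X$ be the inclusion of an affine open subscheme such that $f(U)$ is contained in some affine open subset $V\subset Y$. A morphism $f\colon X\to Y$ is said to be of finite Tor-dimension if there is an integer $d\ge 0$ such that, for every $x\in X$, the $\mathcal{O}_{Y,f(x)}$-module $\mathcal{O}_{X,x}$ has a resolution of length at most $d$ by flat modules. (i) If $f$ is of finite Tor-dimension, then $fu=hg$ for some closed immersion of finite Tor-dimension $g\colon U\to W$ and some smooth morphism $h\colon W\to Y$, where $W$ is a noetherian scheme and $h$ is separated and of finite type. (ii) For arbitrary $f$ (not necessarily of finite Tor-dimension), $fu=khg$ for some open immersion $g\colon U\to W$, some closed immersion $h\colon W\to P$, and some smooth and proper morphism $k\colon P\to Y$, where $W$ and $P$ are noetherian schemes. -/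

import Mathlib

universe u

open CategoryTheory AlgebraicGeometry

/-- `HasFlatDimensionLE R d M`: the `R`-module `M` has flat dimension (Tor-dimension) at most `d`,
that is, there is an exact sequence `0 → P_d → ⋯ → P_1 → P_0 → M → 0` with all `P_i` flat.
The resolution is built one step at a time, by splitting it into short exact sequences
`0 → K → P → M → 0` with `P` flat and `K` of flat dimension at most `d - 1`. -/
def HasFlatDimensionLE (R : Type u) [CommRing R] :
    ℕ → ∀ (M : Type u) [AddCommGroup M] [Module R M], Prop
  | 0, M, _, _ => Module.Flat R M
  | d + 1, M, _, _ =>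
      ∃ (P : Type u) (_ : AddCommGroup P) (_ : Module R P) (π : P →ₗ[R] M),
        Module.Flat R P ∧ Function.Surjective π ∧
          HasFlatDimensionLE R d (LinearMap.ker π)

/-- A morphism of schemes `f : X ⟶ Y` is of finite Tor-dimension if there is one bound `d` such
that, for every point `x` of `X`, the local ring of `X` at `x` has flat dimension at most `d` as
a module over the local ring of `Y` at `f x`. -/
def IsOfFiniteTorDimension {X Y : Scheme.{u}} (f : X ⟶ Y) : Prop :=
  ∃ d : ℕ, ∀ x : X,
    letI : Module (Y.presheaf.stalk (f x)) (X.presheaf.stalk x) := (f.stalkMap x).hom.toModule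
    HasFlatDimensionLE (Y.presheaf.stalk (f x)) d (X.presheaf.stalk x)

/-! Write `R = Γ(Y, V)` and `B = Γ(X, U)`. Since `f` is of finite type, `B` is a quotient of some
`R[X₁, …, Xₙ]`, so `U` is closed in the affine space over `V`.

(i) Take `W` to be this affine space, smooth over `V` and hence over `Y`. What remains is that the
closed immersion has finite Tor-dimension: a module of flat dimension at most `d` over `R` has flat
dimension at most `d + n` over `R[X₁, …, Xₙ]` (`HasFlatDimensionLE.mvPolynomial`). One variable
costs one step, by the exact sequence `0 → R[X] ⊗ M → R[X] ⊗ M → M → 0` with first map `X ⊗ 1 - 1 ⊗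
X`, and `ker_of_projective` reduces to flat `M`. Localization carries the bound to stalks.

(ii) The affine space over `V` is open in the projective space `P` over `Y`, so `U → P` is a
quasi-compact immersion; it factors as an open immersion into its scheme-theoretic image followed by
a closed immersion. Smoothness of `P` is checked on the standard charts (`smooth_away_X`). -/

open TensorProduct

/-! ### Syzygies and change of rings for flat dimension. -/

namespace HasFlatDimensionLE

section Basic

variable {R : Type u} [CommRing R]

lemma of_linearEquiv {d : ℕ} {M N : Type u} [AddCommGroup M] [Module R M] [AddCommGroup N]
    [Module R N] (e : M ≃ₗ[R] N) (h : HasFlatDimensionLE R d M) : HasFlatDimensionLE R d N := by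
  cases d with
  | zero =>
    have : Module.Flat R M := h
    exact Module.Flat.of_linearEquiv e.symm
  | succ d =>
    obtain ⟨P, _, _, π, hP, hπ, hK⟩ := h
    refine ⟨P, _, _, e.toLinearMap ∘ₗ π, hP, e.surjective.comp hπ, ?_⟩
    rwa [LinearEquiv.ker_comp]

lemma succ_of_exact {d : ℕ} {K P M : Type u} [AddCommGroup K] [Module R K] [AddCommGroup P]
    [Module R P] [AddCommGroup M] [Module R M] [hP : Module.Flat R P] (i : K →ₗ[R] P)
    (π : P →ₗ[R] M) (hi : Function.Injective i) (hπ : Function.Surjective π)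
    (hex : Function.Exact i π) (hK : HasFlatDimensionLE R d K) :
    HasFlatDimensionLE R (d + 1) M := by
  refine ⟨P, _, _, π, hP, hπ, ?_⟩
  rw [LinearMap.exact_iff.mp hex]
  exact hK.of_linearEquiv (LinearEquiv.ofInjective i hi)

/-- The kernel of a surjection between flat modules is flat. -/
lemma _root_.Module.Flat.ker_of_surjective {B C : Type u} [AddCommGroup B] [Module R B]
    [AddCommGroup C] [Module R C] [Module.Flat R B] [Module.Flat R C] (g : B →ₗ[R] C)
    (hg : Function.Surjective g) : Module.Flat R (LinearMap.ker g) := by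
  rw [Module.Flat.iff_rTensor_preserves_injective_linearMap]
  intro N N' _ _ _ _ f hf
  -- Flatness of `C` keeps `ker g → B` injective after tensoring with any `A`.
  have h (A : Type u) [AddCommGroup A] [Module R A] :=
    LinearMap.lTensor_injective_of_exact_of_flat g hg (LinearMap.ker g).subtype
      (LinearMap.ker g).subtype_injective (LinearMap.exact_subtype_ker_map g) A
  have hcomp : (LinearMap.ker g).subtype.lTensor N' ∘ₗ f.rTensor (LinearMap.ker g) =
      f.rTensor B ∘ₗ (LinearMap.ker g).subtype.lTensor N := by
    rw [LinearMap.lTensor_comp_rTensor, LinearMap.rTensor_comp_lTensor]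
  have hinj : Function.Injective
      ((LinearMap.ker g).subtype.lTensor N' ∘ₗ f.rTensor (LinearMap.ker g)) := by
    rw [hcomp, LinearMap.coe_comp]
    exact (Module.Flat.rTensor_preserves_injective_linearMap f hf).comp (h N)
  exact Function.Injective.of_comp (by rwa [LinearMap.coe_comp] at hinj)

/-- The kernel of a surjection from a module of flat dimension at most `d` onto a flat module has
flat dimension at most `d`. -/
lemma ker_of_flat {d : ℕ} {B C : Type u} [AddCommGroup B] [Module R B] [AddCommGroup C]
    [Module R C] [Module.Flat R C] (g : B →ₗ[R] C) (hg : Function.Surjective g)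
    (h : HasFlatDimensionLE R d B) : HasFlatDimensionLE R d (LinearMap.ker g) := by
  cases d with
  | zero =>
    have : Module.Flat R B := h
    exact Module.Flat.ker_of_surjective g hg
  | succ d =>
    obtain ⟨Q, _, _, π, hQ, hπ, hK⟩ := h
    -- The preimage of `ker g` in `Q` is the kernel of `Q → C`, hence flat; it covers `ker g` with
    -- the same kernel as `π`.
    have := Module.Flat.ker_of_surjective (g ∘ₗ π) (hg.comp hπ)
    refine succ_of_exact (P := LinearMap.ker (g ∘ₗ π))
      (Submodule.inclusion (LinearMap.ker_le_ker_comp π g))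
      (π.restrict (p := LinearMap.ker (g ∘ₗ π)) (q := LinearMap.ker g) fun x hx ↦ hx)
      (Submodule.inclusion_injective _) ?_ ?_ hK
    · rintro ⟨b, hb⟩
      obtain ⟨q, rfl⟩ := hπ b
      exact ⟨⟨q, hb⟩, rfl⟩
    · rintro ⟨q, hq⟩
      refine ⟨fun h ↦ ⟨⟨q, congrArg Subtype.val h⟩, rfl⟩, ?_⟩
      rintro ⟨⟨q', hq'⟩, h⟩
      obtain rfl : q' = q := congrArg Subtype.val h
      exact Subtype.ext hq'

lemma _root_.Module.Flat.prod {K F : Type u} [AddCommGroup K] [Module R K] [AddCommGroup F]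
    [Module R F] [Module.Flat R K] [Module.Flat R F] : Module.Flat R (K × F) := by
  rw [Module.Flat.iff_lTensor_preserves_injective_linearMap]
  intro N N' _ _ _ _ f hf
  have h : (TensorProduct.prodLeft R R K F N').toLinearMap ∘ₗ f.lTensor (K × F) =
      (f.lTensor K).prodMap (f.lTensor F) ∘ₗ (TensorProduct.prodLeft R R K F N).toLinearMap := by
    ext <;> simp
  refine Function.Injective.of_comp (f := TensorProduct.prodLeft R R K F N') ?_
  rw [← LinearEquiv.coe_toLinearMap, ← LinearMap.coe_comp, h]
  exact ((Module.Flat.lTensor_preserves_injective_linearMap f hf).prodMap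
    (Module.Flat.lTensor_preserves_injective_linearMap f hf)).comp (LinearEquiv.injective _)

lemma prod_flat {d : ℕ} {K F : Type u} [AddCommGroup K] [Module R K] [AddCommGroup F]
    [Module R F] [hF : Module.Flat R F] (h : HasFlatDimensionLE R d K) :
    HasFlatDimensionLE R d (K × F) := by
  cases d with
  | zero =>
    have : Module.Flat R K := h
    exact Module.Flat.prod
  | succ d =>
    obtain ⟨P, _, _, π, hP, hπ, hK⟩ := h
    have := Module.Flat.prod (R := R) (K := P) (F := F)
    refine succ_of_exact (LinearMap.inl R P F ∘ₗ (LinearMap.ker π).subtype)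
      (π.prodMap LinearMap.id) (LinearMap.inl_injective.comp Subtype.val_injective)
      (hπ.prodMap Function.surjective_id) ?_ hK
    rintro ⟨p, x⟩
    constructor
    · intro h
      obtain ⟨h₁, h₂⟩ := Prod.ext_iff.mp h
      exact ⟨⟨p, h₁⟩, Prod.ext rfl h₂.symm⟩
    · rintro ⟨⟨q, hq⟩, h⟩
      obtain ⟨h₁, h₂⟩ := Prod.ext_iff.mp h
      obtain rfl : q = p := h₁
      exact Prod.ext hq h₂.symm

/-- Any first syzygy with respect to a projective module of a module of flat dimension at most
`d + 1` has flat dimension at most `d`. -/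
lemma ker_of_projective {d : ℕ} {F M : Type u} [AddCommGroup F] [Module R F] [AddCommGroup M]
    [Module R M] [Module.Projective R F] (p : F →ₗ[R] M) (hp : Function.Surjective p)
    (h : HasFlatDimensionLE R (d + 1) M) : HasFlatDimensionLE R d (LinearMap.ker p) := by
  obtain ⟨P, _, _, π, hP, hπ, hK⟩ := h
  obtain ⟨s, hs⟩ := Module.projective_lifting_property π p hπ
  have hs' (x : F) : π (s x) = p x := LinearMap.congr_fun hs x
  -- Schanuel's argument: `(k, x)` lies in `ker φ` exactly when `k = -s x`, so the second projection
  -- identifies `ker φ` with `ker p`.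
  let φ : LinearMap.ker π × F →ₗ[R] P := (LinearMap.ker π).subtype.coprod s
  have hφ : Function.Surjective φ := fun y ↦ by
    obtain ⟨x, hx⟩ := hp (π y)
    exact ⟨⟨⟨y - s x, by simp [hs', hx]⟩, x⟩, by simp [φ]⟩
  refine ((hK.prod_flat (F := F)).ker_of_flat φ hφ).of_linearEquiv ?_
  have hφ' (z : LinearMap.ker φ) : (z.1.1 : P) = - s z.1.2 := eq_neg_of_add_eq_zero_left z.2
  refine LinearEquiv.ofBijective
    ((LinearMap.snd R (LinearMap.ker π) F).restrict (p := LinearMap.ker φ) (q := LinearMap.ker p)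
      fun z hz ↦ ?_) ⟨?_, ?_⟩
  · have h := hφ' ⟨z, hz⟩
    have hk : π z.1 = 0 := z.1.2
    rw [LinearMap.mem_ker, LinearMap.snd_apply, ← hs', ← neg_eq_zero, ← map_neg, ← h, hk]
  · intro z w h
    have h₂ : z.1.2 = w.1.2 := congrArg Subtype.val h
    exact Subtype.ext (Prod.ext (Subtype.ext (by rw [hφ', hφ', h₂])) h₂)
  · rintro ⟨x, hx⟩
    exact ⟨⟨⟨⟨-s x, by simpa [hs'] using hx⟩, x⟩, by simp [φ]⟩, rfl⟩

end Basic

section ChangeOfRings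

variable {A R : Type u} [CommRing A] [CommRing R] [Algebra A R]

/-- Flat dimension does not increase under restriction of scalars along a flat homomorphism. -/
lemma restrictScalars [Module.Flat A R] {d : ℕ} {M : Type u} [AddCommGroup M] [Module R M]
    [Module A M] [IsScalarTower A R M] (h : HasFlatDimensionLE R d M) :
    HasFlatDimensionLE A d M := by
  induction d generalizing M with
  | zero =>
    have : Module.Flat R M := h
    exact Module.Flat.trans A R M
  | succ d ih =>
    obtain ⟨P, _, _, π, hP, hπ, hK⟩ := h
    let : Module A P := Module.compHom P (algebraMap A R)
    have : IsScalarTower A R P := .of_algebraMap_smul fun _ _ ↦ rfl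
    have : Module.Flat A P := Module.Flat.trans A R P
    exact succ_of_exact ((LinearMap.ker π).subtype.restrictScalars A) (π.restrictScalars A)
      Subtype.val_injective hπ (LinearMap.exact_subtype_ker_map π) (ih hK)

/-- Flat dimension does not increase under flat base change. -/
lemma baseChange [Module.Flat A R] {d : ℕ} {M : Type u} [AddCommGroup M] [Module A M]
    (h : HasFlatDimensionLE A d M) : HasFlatDimensionLE R d (R ⊗[A] M) := by
  induction d generalizing M with
  | zero =>
    have : Module.Flat A M := h
    exact (inferInstance : Module.Flat R (R ⊗[A] M))
  | succ d ih =>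
    obtain ⟨P, _, _, π, hP, hπ, hK⟩ := h
    exact succ_of_exact ((LinearMap.ker π).subtype.baseChange R) (π.baseChange R)
      (Module.Flat.lTensor_preserves_injective_linearMap _ Subtype.val_injective)
      (LinearMap.lTensor_surjective R hπ)
      (Module.Flat.lTensor_exact R (LinearMap.exact_subtype_ker_map π)) (ih hK)

/-- The flat dimension of a module over a localization can be computed before localizing. -/
lemma of_isLocalization (S : Submonoid A) [IsLocalization S R] {d : ℕ} {M : Type u}
    [AddCommGroup M] [Module R M] [Module A M] [IsScalarTower A R M]
    (h : HasFlatDimensionLE A d M) : HasFlatDimensionLE R d M := by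
  have := IsLocalization.flat R S
  -- An `R`-module is its own localization at `S`, so `R ⊗[A] M` is `M` again.
  have : IsLocalizedModule S (LinearMap.id : M →ₗ[A] M) := isLocalizedModule_id S M R
  have hb := (isLocalizedModule_iff_isBaseChange S R (LinearMap.id : M →ₗ[A] M)).mp this
  exact h.baseChange.of_linearEquiv hb.equiv

end ChangeOfRings

lemma of_ringEquiv {A R : Type u} [CommRing A] [CommRing R] (e : A ≃+* R)
    {d : ℕ} {M : Type u} [AddCommGroup M] [Module R M] [Module A M]
    (he : ∀ (a : A) (m : M), e a • m = a • m) (h : HasFlatDimensionLE A d M) :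
    HasFlatDimensionLE R d M := by
  let : Algebra R A := e.symm.toRingHom.toAlgebra
  have hsmul (r : R) (a : A) : r • a = e.symm r * a := rfl
  have : IsScalarTower R A M := ⟨fun r a m ↦ by
    rw [hsmul, mul_smul, ← he, e.apply_symm_apply]⟩
  have : Module.Flat R A := Module.Flat.of_linearEquiv (N := A) (M := R)
    { e with map_smul' := fun r a ↦ by simp [hsmul] }
  exact h.restrictScalars

end HasFlatDimensionLE

/-! ### Flat dimension over polynomial rings. -/

section PolynomialModule

open Polynomial

variable (R : Type u) [CommRing R] (M : Type u) [AddCommGroup M] [Module R[X] M] [Module R M]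
  [IsScalarTower R R[X] M]

/-- The map `p ⊗ m ↦ X * p ⊗ m - p ⊗ X • m`. -/
noncomputable def Polynomial.tensorXSub : R[X] ⊗[R] M →ₗ[R[X]] R[X] ⊗[R] M :=
  LinearMap.lsmul R[X] _ X - (Module.toModuleEnd R (S := R[X]) M X).baseChange R[X]

/-- The action of `R[X]` on an `R[X]`-module, as an `R[X]`-linear map. -/
noncomputable def Polynomial.tensorAction : R[X] ⊗[R] M →ₗ[R[X]] M :=
  AlgebraTensorModule.lift ((LinearMap.lsmul R[X] M).flip.restrictScalars R).flip

/-- The map `X ^ n ⊗ m ↦ ∑ k < n, X ^ k ⊗ X ^ (n - 1 - k) • m`. -/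
noncomputable def Polynomial.tensorXSubRetraction : R[X] ⊗[R] M →ₗ[R] R[X] ⊗[R] M :=
  TensorProduct.lift (Polynomial.lsum fun n ↦ LinearMap.toSpanSingleton R (M →ₗ[R] R[X] ⊗[R] M)
    (∑ k ∈ Finset.range n, TensorProduct.mk R R[X] M (X ^ k) ∘ₗ
      Module.toModuleEnd R (S := R[X]) M (X ^ (n - 1 - k))))

variable {R M}

lemma Polynomial.tensorXSub_tmul (p : R[X]) (m : M) :
    tensorXSub R M (p ⊗ₜ m) = (X * p) ⊗ₜ m - p ⊗ₜ ((X : R[X]) • m) := rfl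

@[simp]
lemma Polynomial.tensorAction_tmul (p : R[X]) (m : M) : tensorAction R M (p ⊗ₜ m) = p • m := by
  simp [tensorAction]

lemma Polynomial.tensorXSubRetraction_X_pow_tmul (n : ℕ) (m : M) :
    tensorXSubRetraction R M ((X ^ n : R[X]) ⊗ₜ m) =
      ∑ k ∈ Finset.range n, (X ^ k : R[X]) ⊗ₜ[R] ((X ^ (n - 1 - k) : R[X]) • m) := by
  simp [tensorXSubRetraction, Polynomial.lsum_apply, X_pow_eq_monomial, LinearMap.sum_apply,
    sum_monomial_index]

lemma Polynomial.tensor_linearMap_ext {M N : Type*} [AddCommGroup M] [Module R M]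
    [AddCommGroup N] [Module R N]
    {f g : R[X] ⊗[R] M →ₗ[R] N}
    (h : ∀ (n : ℕ) (m : M), f ((X ^ n : R[X]) ⊗ₜ m) = g ((X ^ n : R[X]) ⊗ₜ m)) : f = g := by
  refine TensorProduct.ext (Polynomial.lhom_ext' fun n ↦
    LinearMap.ext_ring (LinearMap.ext fun m ↦ ?_))
  simpa [X_pow_eq_monomial] using h n m

/-- Gives injectivity of `tensorXSub` for every `M`: on `X ^ n ⊗ m` the two sums cancel except for
their top term. -/
lemma Polynomial.tensorXSubRetraction_tensorXSub (t : R[X] ⊗[R] M) :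
    tensorXSubRetraction R M (tensorXSub R M t) = t := by
  suffices h : tensorXSubRetraction R M ∘ₗ (tensorXSub R M).restrictScalars R = LinearMap.id from
    LinearMap.congr_fun h t
  refine tensor_linearMap_ext fun n m ↦ ?_
  simp only [LinearMap.comp_apply, LinearMap.restrictScalars_apply, tensorXSub_tmul, map_sub,
    ← pow_succ', tensorXSubRetraction_X_pow_tmul, LinearMap.id_apply, Finset.sum_range_succ]
  rw [add_sub_right_comm, Nat.add_sub_cancel, Nat.sub_self, pow_zero, one_smul, add_eq_right,
    sub_eq_zero]
  refine Finset.sum_congr rfl fun k hk ↦ ?_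
  rw [smul_smul, ← pow_succ]
  congr 3
  have := Finset.mem_range.mp hk
  omega

/-- Gives exactness in the middle: an element killed by `tensorAction` is `tensorXSub` of its
retraction. On `X ^ n ⊗ m` the sum telescopes. -/
lemma Polynomial.tensorXSub_tensorXSubRetraction (t : R[X] ⊗[R] M) :
    tensorXSub R M (tensorXSubRetraction R M t) = t - 1 ⊗ₜ tensorAction R M t := by
  suffices h : (tensorXSub R M).restrictScalars R ∘ₗ tensorXSubRetraction R M =
      LinearMap.id - TensorProduct.mk R R[X] M 1 ∘ₗ (tensorAction R M).restrictScalars R from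
    LinearMap.congr_fun h t
  refine tensor_linearMap_ext fun n m ↦ ?_
  simp only [LinearMap.comp_apply, LinearMap.restrictScalars_apply, LinearMap.sub_apply,
    tensorXSubRetraction_X_pow_tmul, LinearMap.id_apply, map_sum, tensorXSub_tmul,
    tensorAction_tmul, TensorProduct.mk_apply]
  have h := Finset.sum_range_sub
    (fun k ↦ (X ^ k : R[X]) ⊗ₜ[R] ((X ^ (n - k) : R[X]) • m)) n
  simp only [Nat.sub_self, pow_zero, one_smul, Nat.sub_zero] at h
  rw [← h]
  refine Finset.sum_congr rfl fun k hk ↦ ?_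
  have := Finset.mem_range.mp hk
  rw [smul_smul, ← pow_succ', ← pow_succ', show n - (k + 1) = n - 1 - k by omega,
    show n - 1 - k + 1 = n - k by omega]

namespace HasFlatDimensionLE

lemma polynomial_of_flat [Module.Flat R M] : HasFlatDimensionLE R[X] 1 M := by
  refine succ_of_exact (d := 0) (tensorXSub R M) (tensorAction R M)
    (Function.LeftInverse.injective tensorXSubRetraction_tensorXSub)
    (fun m ↦ ⟨1 ⊗ₜ m, by simp⟩) (fun t ↦ ⟨fun h ↦ ⟨tensorXSubRetraction R M t, ?_⟩, ?_⟩)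
    (inferInstanceAs (Module.Flat R[X] (R[X] ⊗[R] M)))
  · rw [tensorXSub_tensorXSubRetraction, h, tmul_zero, sub_zero]
  · rintro ⟨t, rfl⟩
    suffices h : tensorAction R M ∘ₗ tensorXSub R M = 0 from LinearMap.congr_fun h t
    ext m
    simp [tensorXSub_tmul]

/-- Passing from `R` to `R[X]` increases flat dimensions by at most one. -/
lemma polynomial {d : ℕ} {M : Type u} [AddCommGroup M] [Module R[X] M] [Module R M]
    [IsScalarTower R R[X] M] (h : HasFlatDimensionLE R d M) :
    HasFlatDimensionLE R[X] (d + 1) M := by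
  induction d generalizing M with
  | zero =>
    have : Module.Flat R M := h
    exact polynomial_of_flat
  | succ d ih =>
    -- The free `R[X]`-module on `M` is also free over `R`, so `ker p` has `R`-flat dimension one
    -- less.
    let p := Finsupp.linearCombination R[X] (id : M → M)
    have hp : Function.Surjective p := Finsupp.linearCombination_id_surjective R[X] M
    have hK : HasFlatDimensionLE R d (LinearMap.ker p) :=
      ker_of_projective (p.restrictScalars R) hp h
    exact succ_of_exact (LinearMap.ker p).subtype p Subtype.val_injective hp
      (LinearMap.exact_subtype_ker_map p) (ih hK)

/-- Passing from `R` to a polynomial ring in `n` variables increases flat dimensions by at most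
`n`. -/
lemma mvPolynomial (n : ℕ) {d : ℕ} {M : Type u} [AddCommGroup M] [Module (MvPolynomial (Fin n) R) M]
    [Module R M] [IsScalarTower R (MvPolynomial (Fin n) R) M] (h : HasFlatDimensionLE R d M) :
    HasFlatDimensionLE (MvPolynomial (Fin n) R) (d + n) M := by
  induction n generalizing M with
  | zero =>
    refine h.of_ringEquiv (MvPolynomial.isEmptyAlgEquiv R (Fin 0)).symm.toRingEquiv fun a m ↦ ?_
    exact algebraMap_smul (MvPolynomial (Fin 0) R) a m
  | succ n ih =>
    let e := MvPolynomial.finSuccEquiv R n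
    let : Module (MvPolynomial (Fin n) R)[X] M := Module.compHom M e.symm.toRingEquiv.toRingHom
    let : Module (MvPolynomial (Fin n) R) M :=
      Module.compHom M (algebraMap (MvPolynomial (Fin n) R) (MvPolynomial (Fin n) R)[X])
    have : IsScalarTower (MvPolynomial (Fin n) R) (MvPolynomial (Fin n) R)[X] M :=
      .of_algebraMap_smul fun _ _ ↦ rfl
    have : IsScalarTower R (MvPolynomial (Fin n) R) M := .of_algebraMap_smul fun r m ↦ by
      change e.symm (algebraMap R (MvPolynomial (Fin n) R)[X] r) • m = r • m
      rw [AlgEquiv.commutes, algebraMap_smul]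
    exact (ih h).polynomial.of_ringEquiv e.symm.toRingEquiv fun _ _ ↦ rfl

end HasFlatDimensionLE

end PolynomialModule

/-! ### Flat dimension of ring homomorphisms and of stalk maps. -/

namespace RingHom

variable {R S T T' : Type u} [CommRing R] [CommRing S] [CommRing T] [CommRing T']

/-- `ψ : R →+* T` makes `T` an `R`-module of flat dimension at most `d`. -/
def FlatDimensionLE (ψ : R →+* T) (d : ℕ) : Prop :=
  letI : Module R T := ψ.toModule
  HasFlatDimensionLE R d T

namespace FlatDimensionLE

lemma comp_flat {ψ : S →+* T} {d : ℕ} (h : ψ.FlatDimensionLE d) {φ : R →+* S} (hφ : φ.Flat) :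
    (ψ.comp φ).FlatDimensionLE d := by
  algebraize [φ, ψ, ψ.comp φ]
  exact HasFlatDimensionLE.restrictScalars (A := R) (R := S) (M := T) h

lemma of_comp_isLocalization {ψ : S →+* T} {d : ℕ} (φ : R →+* S) (N : Submonoid R)
    (hφ : letI := φ.toAlgebra; IsLocalization N S) (h : (ψ.comp φ).FlatDimensionLE d) :
    ψ.FlatDimensionLE d := by
  algebraize [φ, ψ, ψ.comp φ]
  exact HasFlatDimensionLE.of_isLocalization (A := R) (R := S) (M := T) N h

lemma of_comp_mvPolynomial {n : ℕ} {ψ : MvPolynomial (Fin n) R →+* T} {d : ℕ}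
    (h : (ψ.comp MvPolynomial.C).FlatDimensionLE d) : ψ.FlatDimensionLE (d + n) := by
  let : Module (MvPolynomial (Fin n) R) T := ψ.toModule
  let : Module R T := (ψ.comp MvPolynomial.C).toModule
  have : IsScalarTower R (MvPolynomial (Fin n) R) T := .of_algebraMap_smul fun _ _ ↦ rfl
  exact HasFlatDimensionLE.mvPolynomial n h

lemma ringEquiv_comp {ψ : R →+* T} {d : ℕ} (h : ψ.FlatDimensionLE d) (e : T ≃+* T') :
    (e.toRingHom.comp ψ).FlatDimensionLE d := by
  let : Module R T := ψ.toModule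
  let : Module R T' := (e.toRingHom.comp ψ).toModule
  exact HasFlatDimensionLE.of_linearEquiv
    (M := T) (N := T') { e with map_smul' := fun r t ↦ map_mul e (ψ r) t } h

lemma of_comp_ringEquiv {ψ : S →+* T} {d : ℕ} {e : R ≃+* S}
    (h : (ψ.comp e.toRingHom).FlatDimensionLE d) : ψ.FlatDimensionLE d := by
  have := h.comp_flat (.of_bijective (f := e.symm.toRingHom) e.symm.bijective)
  rwa [RingHom.comp_assoc, RingEquiv.toRingHom_comp_symm_toRingHom, RingHom.comp_id] at this

end FlatDimensionLE

end RingHom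

namespace AlgebraicGeometry.Spec

variable {R S : CommRingCat.{u}}

/-- The canonical map from a ring to a stalk of its spectrum. -/
noncomputable def toStalk (R : CommRingCat.{u}) (p : Spec R) : R ⟶ (Spec R).presheaf.stalk p :=
  StructureSheaf.toStalk R p

lemma toStalk_stalkMap (φ : R ⟶ S) (p : Spec S) :
    toStalk R (Spec.map φ p) ≫ (Spec.map φ).stalkMap p = φ ≫ toStalk S p :=
  stalkMap_toStalk φ p

lemma isLocalization_toStalk (p : PrimeSpectrum R) :
    letI := (toStalk R p).hom.toAlgebra
    IsLocalization p.asIdeal.primeCompl ((Spec R).presheaf.stalk p) :=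
  StructureSheaf.IsLocalization.to_stalk R p

lemma flat_toStalk (p : PrimeSpectrum R) : (toStalk R p).hom.Flat :=
  letI := (toStalk R p).hom.toAlgebra
  have := isLocalization_toStalk p
  IsLocalization.flat _ p.asIdeal.primeCompl

end AlgebraicGeometry.Spec

namespace IsOfFiniteTorDimension

lemma iff_stalkMap {X Y : Scheme.{u}} {f : X ⟶ Y} :
    IsOfFiniteTorDimension f ↔ ∃ d : ℕ, ∀ x : X, (f.stalkMap x).hom.FlatDimensionLE d := Iff.rfl

variable {X Y Z : Scheme.{u}}

lemma isOpenImmersion_comp {f : Y ⟶ Z} (h : IsOfFiniteTorDimension f) (j : X ⟶ Y)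
    [IsOpenImmersion j] : IsOfFiniteTorDimension (j ≫ f) := by
  obtain ⟨d, h⟩ := iff_stalkMap.mp h
  refine iff_stalkMap.mpr ⟨d, fun x ↦ ?_⟩
  rw [Scheme.Hom.stalkMap_comp]
  exact (h (j x)).ringEquiv_comp (asIso (j.stalkMap x)).commRingCatIsoToRingEquiv

lemma of_comp_isOpenImmersion {f : X ⟶ Y} (j : Y ⟶ Z) [IsOpenImmersion j]
    (h : IsOfFiniteTorDimension (f ≫ j)) : IsOfFiniteTorDimension f := by
  obtain ⟨d, h⟩ := iff_stalkMap.mp h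
  refine iff_stalkMap.mpr ⟨d, fun x ↦ ?_⟩
  have h := h x
  rw [Scheme.Hom.stalkMap_comp] at h
  exact .of_comp_ringEquiv (e := (asIso (j.stalkMap (f x))).commRingCatIsoToRingEquiv) h

/-- A ring homomorphism out of a polynomial ring `R[X₁, …, Xₙ]` is of finite Tor-dimension if its
restriction to `R` is. -/
lemma of_comp_SpecMap_C {R T : CommRingCat.{u}} {n : ℕ}
    (s : CommRingCat.of (MvPolynomial (Fin n) R) ⟶ T)
    (h : IsOfFiniteTorDimension (Spec.map s ≫ Spec.map (CommRingCat.ofHom MvPolynomial.C))) :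
    IsOfFiniteTorDimension (Spec.map s) := by
  obtain ⟨d, h⟩ := iff_stalkMap.mp h
  refine iff_stalkMap.mpr ⟨d + n, fun p ↦ ?_⟩
  set c : R ⟶ CommRingCat.of (MvPolynomial (Fin n) R) := CommRingCat.ofHom MvPolynomial.C
  have h := h p
  rw [Scheme.Hom.stalkMap_comp] at h
  -- Precomposing with the flat map from `R` to its stalk bounds the flat dimension over `R` itself.
  -- Naturality then exhibits the map as factoring through the polynomial ring, where the bound
  -- becomes `d + n`.
  have h : (Spec.toStalk R (Spec.map c (Spec.map s p)) ≫
      (Spec.map c).stalkMap (Spec.map s p) ≫ (Spec.map s).stalkMap p).hom.FlatDimensionLE d :=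
    h.comp_flat (Spec.flat_toStalk _)
  rw [← Category.assoc, Spec.toStalk_stalkMap, Category.assoc] at h
  refine .of_comp_isLocalization (Spec.toStalk _ (Spec.map s p)).hom _
    (Spec.isLocalization_toStalk _) ?_
  exact .of_comp_mvPolynomial h

end IsOfFiniteTorDimension

/-! ### Part (i): closed immersion into affine space. -/

namespace AlgebraicGeometry

/-- If `f` is of finite Tor-dimension, an affine open of `X` mapping into an affine open `V` of `Y`
admits a closed immersion of finite Tor-dimension into an affine space over `V`. -/
theorem exists_closedImmersion_smooth {X Y : Scheme.{u}} [IsLocallyNoetherian Y]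
    (f : X ⟶ Y) [LocallyOfFiniteType f] {U : X.Opens} (hU : IsAffineOpen U) {V : Y.Opens}
    (hV : IsAffineOpen V) (hUV : U ≤ f ⁻¹ᵁ V) (hf : IsOfFiniteTorDimension f) :
    ∃ (W : Scheme.{u}) (g : U.toScheme ⟶ W) (h : W ⟶ Y),
      IsNoetherian W ∧ (IsClosedImmersion g ∧ IsOfFiniteTorDimension g) ∧
      (Smooth h ∧ QuasiCompact h ∧ IsSeparated h) ∧ U.ι ≫ f = g ≫ h := by
  let φ := f.appLE V U hUV
  have hφ : φ.hom.FiniteType := f.finiteType_appLE hV hU hUV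
  algebraize [φ.hom]
  obtain ⟨n, s, hs⟩ := Algebra.FiniteType.iff_quotient_mvPolynomial''.mp hφ
  let c : Γ(Y, V) ⟶ CommRingCat.of (MvPolynomial (Fin n) Γ(Y, V)) :=
    CommRingCat.ofHom MvPolynomial.C
  let s' : CommRingCat.of (MvPolynomial (Fin n) Γ(Y, V)) ⟶ Γ(X, U) :=
    CommRingCat.ofHom s.toRingHom
  have hcs : c ≫ s' = φ := by
    ext a
    exact s.commutes a
  have hcomp : Spec.map s' ≫ Spec.map c ≫ hV.fromSpec = hU.fromSpec ≫ f := by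
    rw [← Spec.map_comp_assoc, hcs, IsAffineOpen.SpecMap_appLE_fromSpec]
  have : IsNoetherianRing Γ(Y, V) := IsLocallyNoetherian.component_noetherian ⟨V, hV⟩
  have : IsClosedImmersion (Spec.map s') := IsClosedImmersion.spec_of_surjective _ hs
  have hc : Smooth (Spec.map c) := by
    refine (HasRingHomProperty.Spec_iff (P := @Smooth)).mpr ?_
    exact (RingHom.smooth_algebraMap (R := Γ(Y, V)) (S := MvPolynomial (Fin n) Γ(Y, V))).mpr
      ⟨inferInstance, inferInstance⟩
  refine ⟨_, hU.isoSpec.hom ≫ Spec.map s', Spec.map c ≫ hV.fromSpec, inferInstance,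
    ⟨inferInstance, ?_⟩, ⟨inferInstance, inferInstance, inferInstance⟩, ?_⟩
  · refine IsOfFiniteTorDimension.isOpenImmersion_comp
      (.of_comp_SpecMap_C _ (.of_comp_isOpenImmersion hV.fromSpec ?_)) _
    rw [Category.assoc, hcomp]
    exact hf.isOpenImmersion_comp hU.fromSpec
  · rw [Category.assoc, hcomp, IsAffineOpen.isoSpec_hom_fromSpec_assoc]

end AlgebraicGeometry

/-! ### Smoothness of the standard charts of projective space. -/

/-- A retract of a formally smooth algebra is formally smooth. -/
lemma Algebra.FormallySmooth.of_retract {R A B : Type*} [CommRing R] [CommRing A] [CommRing B]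
    [Algebra R A] [Algebra R B] [Algebra.FormallySmooth R A] (i : B →ₐ[R] A) (r : A →ₐ[R] B)
    (h : r.comp i = AlgHom.id R B) : Algebra.FormallySmooth R B := by
  refine Algebra.FormallySmooth.iff_comp_surjective.mpr fun C _ _ I hI f ↦ ?_
  obtain ⟨g, hg⟩ := Algebra.FormallySmooth.comp_surjective R A I hI (f.comp r)
  exact ⟨g.comp i, by
    rw [← AlgHom.comp_assoc, hg, AlgHom.comp_assoc, h, AlgHom.comp_id]⟩

namespace MvPolynomial

/-- Each monomial of `p` has degree `n` and contributes `c ^ n`. It serves to clear denominators in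
`X j / X i`. -/
lemma IsHomogeneous.eval₂_mul {σ R S : Type*} [CommRing R] [CommRing S] {p : MvPolynomial σ R}
    {n : ℕ} (hp : p.IsHomogeneous n) (f : R →+* S) (c : S) (g : σ → S) :
    p.eval₂ f (fun i ↦ c * g i) = c ^ n * p.eval₂ f g := by
  rw [eval₂_eq, eval₂_eq, Finset.mul_sum]
  refine Finset.sum_congr rfl fun d hd ↦ ?_
  have hdeg : d.degree = n := by
    rw [Finsupp.degree_eq_weight_one]
    exact hp (mem_support_iff.mp hd)
  simp_rw [mul_pow, Finset.prod_mul_distrib]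
  rw [Finset.prod_pow_eq_pow_sum, ← Finsupp.degree_apply, hdeg]
  ring

attribute [local instance] MvPolynomial.gradedAlgebra

variable (σ : Type) (k : Type u) [CommRing k]

lemma algebraMap_homogeneousSubmodule_zero_bijective :
    Function.Bijective (algebraMap k (homogeneousSubmodule σ k 0)) := by
  constructor
  · intro a b h
    exact C_injective σ k (congrArg Subtype.val h)
  · rintro ⟨p, hp⟩
    have hp' := hp
    rw [homogeneousSubmodule_zero, Submodule.mem_one] at hp'
    obtain ⟨c, hc⟩ := hp'
    exact ⟨c, Subtype.ext hc⟩

lemma X_mem_homogeneousSubmodule (i : σ) : X i ∈ homogeneousSubmodule σ k 1 :=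
  isHomogeneous_X k i

/-- This is what makes the charts `X i ≠ 0` cover `Proj`. -/
lemma irrelevant_le_span_X :
    (HomogeneousIdeal.irrelevant (homogeneousSubmodule σ k)).toIdeal ≤
      Ideal.span (Set.range (X : σ → MvPolynomial σ k)) := by
  intro p hp
  rw [← Set.image_univ, mem_ideal_span_X_image]
  intro m hm
  by_contra! h
  obtain rfl : m = 0 := Finsupp.ext fun i ↦ h i trivial
  have h0 : homogeneousComponent 0 p = 0 := by
    rw [← decomposition.decompose'_apply]
    exact (HomogeneousIdeal.mem_irrelevant_iff _ _).mp hp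
  apply mem_support_iff.mp hm
  simpa [coeff_homogeneousComponent] using congrArg (coeff 0) h0

instance isScalarTower_homogeneousSubmodule_zero :
    IsScalarTower k (homogeneousSubmodule σ k 0) (MvPolynomial σ k) :=
  IsScalarTower.of_algebraMap_eq (R := k) (S := homogeneousSubmodule σ k 0)
    (A := MvPolynomial σ k) fun _ ↦ rfl

/-- The degree-zero part is a quotient of `k`, hence formally unramified over it, so formal
smoothness over `k` passes to it. -/
instance formallySmooth_homogeneousSubmodule_zero :
    Algebra.FormallySmooth (homogeneousSubmodule σ k 0) (MvPolynomial σ k) := by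
  have : Algebra.FormallyUnramified k (homogeneousSubmodule σ k 0) :=
    .of_surjective (Algebra.ofId k _) (algebraMap_homogeneousSubmodule_zero_bijective σ k).2
  exact .of_restrictScalars k _ _

instance finiteType_homogeneousSubmodule_zero [Finite σ] :
    Algebra.FiniteType (homogeneousSubmodule σ k 0) (MvPolynomial σ k) :=
  .of_restrictScalars_finiteType k _ _

open HomogeneousLocalization in
/-- The standard affine charts of projective space are smooth. -/
lemma smooth_away_X [Finite σ] [IsNoetherianRing k] (i : σ) :
    Algebra.Smooth (homogeneousSubmodule σ k 0) (Away (homogeneousSubmodule σ k) (X i)) := by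
  have hX := X_mem_homogeneousSubmodule σ k
  have hbij := algebraMap_homogeneousSubmodule_zero_bijective σ k
  have : IsNoetherianRing (homogeneousSubmodule σ k 0) :=
    isNoetherianRing_of_surjective _ _ _ hbij.2
  have := Away.finiteType (𝒜 := homogeneousSubmodule σ k) (X i) 1 (hX i)
  refine ⟨?_, Algebra.FinitePresentation.of_finiteType.mp this⟩
  let x (j : σ) : Away (homogeneousSubmodule σ k) (X i) :=
    Away.mk _ (hX i) 1 (X j) (by simpa using hX j)
  have hx : x i = 1 := by
    ext
    simp [x]
  -- Dehomogenization `X j ↦ X j / X i`. It sends `X i` to `1`, so it extends to the localization at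
  -- `X i` and retracts that smooth algebra onto its degree-zero part.
  let r₀ : MvPolynomial σ k →+* Away (homogeneousSubmodule σ k) (X i) :=
    eval₂Hom ((algebraMap (homogeneousSubmodule σ k 0) _).comp (algebraMap k _)) x
  have hr₀ : IsUnit (r₀ (X i)) := by simp [r₀, hx]
  let r : Localization.Away (X i : MvPolynomial σ k) →ₐ[homogeneousSubmodule σ k 0]
      Away (homogeneousSubmodule σ k) (X i) :=
    { Localization.awayLift r₀ (X i) hr₀ with
      commutes' a := by
        obtain ⟨c, rfl⟩ := hbij.2 a
        change Localization.awayLift r₀ (X i) hr₀ (algebraMap (MvPolynomial σ k) _ (C c)) = _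
        rw [IsLocalization.Away.lift_eq]
        simp [r₀] }
  refine .of_retract (A := Localization.Away (X i : MvPolynomial σ k))
    (IsScalarTower.toAlgHom _ _ _) r ?_
  ext z
  obtain ⟨n, p, hp, rfl⟩ := Away.mk_surjective (homogeneousSubmodule σ k) (hX i) z
  have hr : r (Localization.mk p ⟨X i ^ n, n, rfl⟩) = r₀ p := by
    refine (Localization.awayLift_mk r₀ (X i) p 1 (by simp [r₀, hx]) n).trans ?_
    rw [one_pow, mul_one]
  let v := algebraMap (Away (homogeneousSubmodule σ k) (X i))
    (Localization.Away (X i : MvPolynomial σ k))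
  let a := algebraMap (MvPolynomial σ k) (Localization.Away (X i : MvPolynomial σ k))
  have hv (j : σ) : a (X i) * v (x j) = a (X j) := by
    simp only [v, x, a]
    rw [HomogeneousLocalization.algebraMap_apply, Away.val_mk, Localization.mk_eq_mk', mul_comm]
    simp_rw [pow_one]
    exact IsLocalization.mk'_spec _ _ _
  -- Homogeneity of `p` turns substituting `X j / X i` into division by the power of `X i`.
  have hp' : v (r₀ p) * a (X i) ^ n = a p := by
    rw [mul_comm, coe_eval₂Hom, hom_eval₂, ← IsHomogeneous.eval₂_mul (by simpa using hp)]
    simp_rw [hv]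
    conv_rhs => rw [← eval₂_eta p, hom_eval₂]
    rfl
  change v (r (Localization.mk p ⟨X i ^ n, n, rfl⟩)) =
    Localization.mk p (⟨X i ^ n, n, rfl⟩ : Submonoid.powers (X i : MvPolynomial σ k))
  rw [hr, Localization.mk_eq_mk', IsLocalization.eq_mk'_iff_mul_eq, map_pow]
  exact hp'

end MvPolynomial

/-! ### Projective space and maps into its affine chart. -/

namespace AlgebraicGeometry

open MvPolynomial Limits

attribute [local instance] MvPolynomial.gradedAlgebra

instance smooth_proj_toSpecZero (σ : Type) (k : Type u) [CommRing k] [Finite σ]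
    [IsNoetherianRing k] : Smooth (Proj.toSpecZero (homogeneousSubmodule σ k)) := by
  let 𝒰 := Proj.affineOpenCoverOfIrrelevantLESpan (homogeneousSubmodule σ k) (X : σ → _)
    (X_mem_homogeneousSubmodule σ k) (fun _ ↦ one_pos) (irrelevant_le_span_X σ k)
  have : IsZariskiLocalAtSource @Smooth.{u} := HasRingHomProperty.instIsZariskiLocalAtSource
  refine (IsZariskiLocalAtSource.iff_of_openCover (P := @Smooth) 𝒰.openCover).mpr fun (i : σ) ↦ ?_
  change Smooth (Proj.awayι _ _ _ _ ≫ Proj.toSpecZero _)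
  rw [Proj.awayι_toSpecZero]
  refine (HasRingHomProperty.Spec_iff (P := @Smooth)).mpr ?_
  exact RingHom.smooth_algebraMap.mpr (smooth_away_X σ k i)

/-- The degree-zero part of a polynomial ring over `ℤ` has terminal spectrum. -/
noncomputable def specHomogeneousZeroIsTerminal (σ : Type) :
    IsTerminal (Spec (.of (homogeneousSubmodule σ (ULift.{u} ℤ) 0))) :=
  specULiftZIsTerminal.ofIso (Scheme.Spec.mapIso (RingEquiv.ofBijective _
    (algebraMap_homogeneousSubmodule_zero_bijective σ (ULift.{u} ℤ))).toCommRingCatIso.op).symm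

/-- On global sections the image contains `φ(A)` through the first projection and every `b j`
through the second, and these generate `B`; `β` alone need not be surjective. -/
lemma isClosedImmersion_pullback_lift {A B C R : CommRingCat.{u}} {n : ℕ} {φ : A ⟶ B} {β : C ⟶ B}
    (α : R ⟶ A) (γ : R ⟶ C) (h : α ≫ φ = γ ≫ β) (b : Fin n → B)
    (hb : Function.Surjective (MvPolynomial.eval₂Hom φ.hom b)) (hβ : ∀ j, ∃ c, β c = b j) :
    IsClosedImmersion (pullback.lift (f := Spec.map α) (g := Spec.map γ) (Spec.map φ) (Spec.map β)
      (by rw [← Spec.map_comp, ← Spec.map_comp, h])) := by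
  set q := pullback.lift (f := Spec.map α) (g := Spec.map γ) (Spec.map φ) (Spec.map β)
      (by rw [← Spec.map_comp, ← Spec.map_comp, h])
  have hfst : q ≫ pullback.fst _ _ = Spec.map φ := pullback.lift_fst _ _ _
  have hsnd : q ≫ pullback.snd _ _ = Spec.map β := pullback.lift_snd _ _ _
  have key {D : CommRingCat.{u}} {δ : D ⟶ B} (p : pullback (Spec.map α) (Spec.map γ) ⟶ Spec D)
      (hp : q ≫ p = Spec.map δ) (d : D) :
      (Scheme.ΓSpecIso B).inv (δ d) ∈ q.appTop.hom.range := by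
    refine ⟨p.appTop ((Scheme.ΓSpecIso D).inv d), ?_⟩
    have := Scheme.ΓSpecIso_inv_naturality δ
    rw [← hp, Scheme.Hom.comp_appTop] at this
    exact (ConcreteCategory.congr_hom this d).symm
  refine IsClosedImmersion.of_surjective_of_isAffine _ fun y ↦ ?_
  obtain ⟨y, rfl⟩ := (ConcreteCategory.bijective_of_isIso (Scheme.ΓSpecIso B).inv).2 y
  obtain ⟨p, rfl⟩ := hb y
  change _ ∈ q.appTop.hom.range
  induction p using MvPolynomial.induction_on with
  | C a => simpa using key _ hfst a
  | add p p' hp hp' => rw [map_add, map_add]; exact add_mem hp hp'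
  | mul_X p j hp =>
    rw [map_mul, map_mul]
    refine mul_mem hp ?_
    obtain ⟨c, hc⟩ := hβ j
    simpa [hc] using key _ hsnd c

/-- A tuple of elements of `B` defines a homomorphism from the coordinate ring of a standard affine
chart of projective space to `B`. -/
lemma exists_away_X_hom {n : ℕ} (B : CommRingCat.{u}) (b : Fin n → B) :
    ∃ β : CommRingCat.of (HomogeneousLocalization.Away
        (homogeneousSubmodule (Option (Fin n)) (ULift.{u} ℤ)) (X none)) ⟶ B,
      ∀ j, ∃ c, β c = b j := by
  -- The extra variable `X none` goes to `1`, so `X (some j) / X none` maps to `b j`.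
  let e : MvPolynomial (Option (Fin n)) (ULift.{u} ℤ) →+* B :=
    eval₂Hom ((Int.castRingHom B).comp ULift.ringEquiv.toRingHom) fun o ↦ o.elim 1 b
  have he : IsUnit (e (X none)) := by simp [e]
  refine ⟨CommRingCat.ofHom ((Localization.awayLift e (X none) he).comp (algebraMap _ _)),
    fun j ↦ ⟨HomogeneousLocalization.Away.mk _ (X_mem_homogeneousSubmodule _ _ _) 1 (X (some j))
      (by simpa using X_mem_homogeneousSubmodule _ _ _), ?_⟩⟩
  change Localization.awayLift e (X none) he (Localization.mk (X (some j)) ⟨X none ^ 1, 1, rfl⟩) = _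
  refine (Localization.awayLift_mk e (X none) _ 1 (by simp [e]) 1).trans ?_
  simp [e]

end AlgebraicGeometry

/-! ### Part (ii): compactification in projective space. -/

namespace AlgebraicGeometry

open MvPolynomial Limits

attribute [local instance] MvPolynomial.gradedAlgebra

/-- An affine open of `X` mapping into an affine open of `Y` admits an open immersion into a closed
subscheme of a projective space over `Y`. -/
theorem exists_openImmersion_closedImmersion_smooth_proper {X Y : Scheme.{u}}
    [IsLocallyNoetherian X] [IsNoetherian Y] (f : X ⟶ Y) [LocallyOfFiniteType f]
    {U : X.Opens} (hU : IsAffineOpen U) {V : Y.Opens} (hV : IsAffineOpen V)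
    (hUV : U ≤ f ⁻¹ᵁ V) :
    ∃ (W P : Scheme.{u}) (g : U.toScheme ⟶ W) (h : W ⟶ P) (k : P ⟶ Y),
      (IsNoetherian W ∧ IsNoetherian P) ∧ IsOpenImmersion g ∧ IsClosedImmersion h ∧
      (Smooth k ∧ IsProper k) ∧ U.ι ≫ f = g ≫ h ≫ k := by
  let φ := f.appLE V U hUV
  have hφ : φ.hom.FiniteType := f.finiteType_appLE hV hU hUV
  algebraize [φ.hom]
  obtain ⟨n, s, hs⟩ := Algebra.FiniteType.iff_quotient_mvPolynomial''.mp hφ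
  obtain ⟨β, hβ⟩ := exists_away_X_hom Γ(X, U) fun j ↦ s (MvPolynomial.X j)
  let 𝒜 := homogeneousSubmodule (Option (Fin n)) (ULift.{u} ℤ)
  have : IsNoetherianRing (ULift.{u} ℤ) :=
    isNoetherianRing_of_ringEquiv ℤ ULift.ringEquiv.symm
  let t : IsTerminal (Spec (.of (𝒜 0))) := specHomogeneousZeroIsTerminal.{u} (Option (Fin n))
  let α : CommRingCat.of (𝒜 0) ⟶ Γ(Y, V) := Spec.preimage (t.from _)
  let γ : CommRingCat.of (𝒜 0) ⟶ .of (HomogeneousLocalization.Away 𝒜 (MvPolynomial.X none)) :=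
    CommRingCat.ofHom (HomogeneousLocalization.fromZeroRingHom 𝒜
    (Submonoid.powers (MvPolynomial.X none)))
  have hs' : eval₂Hom φ.hom (fun j ↦ s (MvPolynomial.X j)) = s.toRingHom :=
    MvPolynomial.ringHom_ext (fun a ↦ (eval₂Hom_C _ _ a).trans (s.commutes a).symm) (fun j ↦ by simp)
  have hq := isClosedImmersion_pullback_lift α γ (Spec.map_injective (t.hom_ext _ _))
    (fun j ↦ s (MvPolynomial.X j)) (φ := φ) (β := β) (by rw [hs']; exact hs) hβ
  have hw : Spec.map φ ≫ Spec.map α = Spec.map β ≫ Spec.map γ := t.hom_ext _ _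
  let q := pullback.lift (Spec.map φ) (Spec.map β) hw
  have hq : IsClosedImmersion q := hq
  -- Projective `n`-space over `Y`, as a base change from the integers (lifted to universe `u`); `m`
  -- is the inclusion of its chart `X none ≠ 0` over `V`.
  let P := pullback (t.from Y) (Proj.toSpecZero 𝒜)
  let m : pullback (Spec.map α) (Spec.map γ) ⟶ P :=
    pullback.map _ _ _ _ hV.fromSpec
      (Proj.awayι 𝒜 (MvPolynomial.X none) (X_mem_homogeneousSubmodule _ _ _) one_pos) (𝟙 _)
      (t.hom_ext _ _) (t.hom_ext _ _)
  have : IsOpenImmersion m := inferInstance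
  let k : P ⟶ Y := pullback.fst _ _
  have : Smooth k := inferInstance
  have : IsProper k := inferInstance
  have : IsLocallyNoetherian P := LocallyOfFiniteType.isLocallyNoetherian k
  have : CompactSpace P := QuasiCompact.compactSpace_of_compactSpace k
  have : IsNoetherian P := {}
  let j : U.toScheme ⟶ P := hU.isoSpec.hom ≫ q ≫ m
  have hj : j ≫ k = U.ι ≫ f := by
    have h₁ : m ≫ k = pullback.fst _ _ ≫ hV.fromSpec := pullback.lift_fst _ _ _
    have h₂ : q ≫ pullback.fst _ _ = Spec.map φ := pullback.lift_fst _ _ _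
    simp only [j, Category.assoc, h₁]
    rw [reassoc_of% h₂, IsAffineOpen.SpecMap_appLE_fromSpec _ hV hU,
      IsAffineOpen.isoSpec_hom_fromSpec_assoc]
  have : IsImmersion j := inferInstance
  have : CompactSpace U.toScheme := isCompact_iff_compactSpace.mp hU.isCompact
  have : IsNoetherian U.toScheme := {}
  -- Quasi-compactness makes the immersion `j` open in its scheme-theoretic image.
  have : QuasiCompact j := inferInstance
  have : IsLocallyNoetherian j.image := LocallyOfFiniteType.isLocallyNoetherian j.imageι
  have : CompactSpace j.image := QuasiCompact.compactSpace_of_compactSpace j.imageι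
  have : IsNoetherian j.image := {}
  exact ⟨j.image, P, j.toImage, j.imageι, k, ⟨inferInstance, inferInstance⟩, inferInstance,
    inferInstance, ⟨inferInstance, inferInstance⟩, by rw [j.toImage_imageι_assoc, hj]⟩

end AlgebraicGeometry

theorem lemmaL2p2055 {X Y : Scheme.{u}} [IsNoetherian X] [IsNoetherian Y]
    (f : X ⟶ Y) [LocallyOfFiniteType f] [QuasiCompact f]
    (U : X.Opens) (hU : IsAffineOpen U)
    (hUV : ∃ V : Y.Opens, IsAffineOpen V ∧ U ≤ f ⁻¹ᵁ V) :
    (IsOfFiniteTorDimension f →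
      ∃ (W : Scheme.{u}) (g : U.toScheme ⟶ W) (h : W ⟶ Y),
        IsNoetherian W ∧
        (IsClosedImmersion g ∧ IsOfFiniteTorDimension g) ∧
        (Smooth h ∧ QuasiCompact h ∧ IsSeparated h) ∧
        U.ι ≫ f = g ≫ h) ∧
    (∃ (W P : Scheme.{u}) (g : U.toScheme ⟶ W) (h : W ⟶ P) (k : P ⟶ Y),
      (IsNoetherian W ∧ IsNoetherian P) ∧
      IsOpenImmersion g ∧
      IsClosedImmersion h ∧
      (Smooth k ∧ IsProper k) ∧
      U.ι ≫ f = g ≫ h ≫ k) := by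
  obtain ⟨V, hV, hUV⟩ := hUV
  exact ⟨exists_closedImmersion_smooth f hU hV hUV,
    exists_openImmersion_closedImmersion_smooth_proper f hU hV hUV⟩
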